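/- A permutation of length $n$ is written $p=p_1p_2\cdots p_n$, and $\mathfrak S_n$ is the set of all permutations of length $n$. A copy of a pattern $q=q_1\cdots q_m\in\mathfrak S_m$ in $p\in\mathfrak S_n$ is a choice of indices $i_1<\cdots<i_m$ such that, for all $r,s$, $p_{i_r}<p_{i_s}$ if and only if $q_r<q_s$. Let $S_n(q,1)$ denote the number of permutations of length $n$ that contain exactly one copy of $q$. For $\sigma\in\mathfrak S_a$ and $\tau\in\mathfrak S_b$, the skew-sum $\sigma\ominus\tau\in\mathfrak S_{a+b}$ is defined by $(\sigma\ominus\tau)(i)=\sigma(i)+b$ for $i\le a$ and $(\sigma\ominus\tau)(i)=\tau(i-a)$ for $i>a$. Theorem. Let $k\ge 3$ and $\rho\in\mathfrak S_{k-3}$ (for $k=3$, $\rho$ is the empty permutation). Then the ordinary generating function $$A_{321\ominus\rho,1}(z)=\sum_{n\ge 0} S_n(321\ominus\rho,1)\,z^n$$ is not rational, that is, there are no polynomials $P,Q\in\mathbb C[z]$ with $Q\neq 0$ and $Q(z)\,A_{321\ominus\rho,1}(z)=P(z)$ as formal power series. -/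

import Mathlib

/-- The skew-sum `σ ⊖ τ`: positions `0, …, a-1` carry `σ` with all values raised by `b`, and
positions `a, …, a+b-1` carry `τ`. Permutations of length `n` are permutations of
`Fin n = {0, …, n-1}`, in one-line notation `p 0, p 1, …, p (n-1)`. -/
def skewSum {a b : ℕ} (σ : Equiv.Perm (Fin a)) (τ : Equiv.Perm (Fin b)) :
    Equiv.Perm (Fin (a + b)) :=
  finSumFinEquiv.symm.trans <| (Equiv.sumCongr σ τ).trans <|
    (Equiv.sumComm (Fin a) (Fin b)).trans <| finSumFinEquiv.trans (finCongr (Nat.add_comm b a))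

theorem skewSum_left {a b : ℕ} (σ : Equiv.Perm (Fin a)) (τ : Equiv.Perm (Fin b)) (i : Fin a) :
    (skewSum σ τ (Fin.castAdd b i) : ℕ) = σ i + b := by
  simp [skewSum, Nat.add_comm]

theorem skewSum_right {a b : ℕ} (σ : Equiv.Perm (Fin a)) (τ : Equiv.Perm (Fin b)) (i : Fin b) :
    (skewSum σ τ (Fin.natAdd a i) : ℕ) = τ i := by
  simp [skewSum]

/-- The pattern `321`. -/
def pattern321 : Equiv.Perm (Fin 3) := Fin.revPerm

/-- The copies of the pattern `q` in the permutation `p`: the choices of indices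
`i₁ < ⋯ < iₘ` such that `p i₁, …, p iₘ` is order-isomorphic to `q`. -/
def copies {m n : ℕ} (q : Equiv.Perm (Fin m)) (p : Equiv.Perm (Fin n)) : Set (Fin m ↪o Fin n) :=
  {i | ∀ r s : Fin m, p (i r) < p (i s) ↔ q r < q s}

/-- The number of permutations of length `n` that contain exactly `r` copies of `q`. -/
noncomputable def numPermsWithCopies {m : ℕ} (q : Equiv.Perm (Fin m)) (r n : ℕ) : ℕ :=
  {p : Equiv.Perm (Fin n) | (copies q p).ncard = r}.ncard

/-- The ordinary generating function `∑ₙ Sₙ(q, r) zⁿ`, with complex coefficients. -/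
noncomputable def copiesGenFun {m : ℕ} (q : Equiv.Perm (Fin m)) (r : ℕ) : PowerSeries ℂ :=
  PowerSeries.mk fun n => (numPermsWithCopies q r n : ℂ)

/-- A power series over a field is rational if it is a quotient `P / Q` of two polynomials,
`Q ≠ 0`. -/
def IsRationalSeries {K : Type*} [Field K] (A : PowerSeries K) : Prop :=
  ∃ P Q : Polynomial K, Q ≠ 0 ∧ (Q : PowerSeries K) * A = (P : PowerSeries K)

/-!
Write `q = 321 ⊖ ρ`, let `sₙ` be the number of permutations of length `n` avoiding `q`, and `aₙ` the
number of those with exactly one copy of `q`. All that is used of `q` is that it has length at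
least `3`, its first entry is its largest and its second entry exceeds all later ones; the last two
properties are the hypothesis `hq` below.
Three inequalities carry the proof.

* `aₙ ≤ n sₙ` (`numPermsWithCopies_one_le`). If `c b a …` is the only copy of `q`, then `c` is the
  only entry preceding and exceeding `b`. Exchanging `c` and `b` destroys the copy and creates none,
  and the position of `b` suffices to undo the exchange.
* `∑_{i+j=n} sᵢ sⱼ ≤ sₙ₊₁` (`sum_antidiagonal_numPermsWithCopies_le`). An avoider `σ` of length `i`
  is turned injectively into an indecomposable avoider `liftPerm σ` of length `i + 1`, so that
  `liftPerm σ ⊕ τ` determines both `σ` and `τ`.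
* `sₙ ≤ a_{k+n}` (`numPermsWithCopies_zero_le`), since `q ⊕ τ` has a single copy of `q` whenever `τ`
  avoids `q`.

Let `R` be the radius of convergence of `A(z) = ∑ aₙ zⁿ`; if `A` is rational, then `R > 0`. By the
third inequality `S(z) = ∑ sₙ zⁿ` converges for `|z| < R`, by the second one `z S(z)² ≤ S(z)`, hence
`S(r) ≤ 1 / r` for `0 < r < R`, and so `∑ sₙ Rⁿ` converges. Now the first inequality and dominated
convergence give `(R - r) A(r) → 0` as `r → R⁻`. As the coefficients are nonnegative, `A` has no
pole on the circle `|z| = R`; so a rational `A` would converge on a larger disc, which contradicts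
the choice of `R`.
-/

open Filter Topology

/-! ### Rational power series and their poles -/

/-- If `B = (X - ζ) A` converges absolutely at radius `r < ‖ζ‖`, then so does `A`. -/
theorem summable_norm_coeff_of_X_sub_C_mul {A : PowerSeries ℂ} {ζ : ℂ} {r : ℝ} (hr : 0 ≤ r)
    (hζ : r < ‖ζ‖)
    (h : Summable fun n => ‖PowerSeries.coeff n
      (((Polynomial.X - Polynomial.C ζ : Polynomial ℂ) : PowerSeries ℂ) * A)‖ * r ^ n) :
    Summable fun n => ‖PowerSeries.coeff n A‖ * r ^ n := by
  set B : PowerSeries ℂ := ((Polynomial.X - Polynomial.C ζ : Polynomial ℂ) : PowerSeries ℂ) * A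
    with hB
  have hB' : B = PowerSeries.X * A - PowerSeries.C ζ * A := by
    rw [hB]; push_cast; ring
  have h0 : ‖ζ‖ * ‖PowerSeries.coeff 0 A‖ = ‖PowerSeries.coeff 0 B‖ := by
    rw [hB', map_sub, PowerSeries.coeff_zero_X_mul, PowerSeries.coeff_C_mul]; simp
  have hs : ∀ n, ‖ζ‖ * ‖PowerSeries.coeff (n + 1) A‖
      ≤ ‖PowerSeries.coeff (n + 1) B‖ + ‖PowerSeries.coeff n A‖ := by
    intro n
    have : PowerSeries.coeff (n + 1) B
        = PowerSeries.coeff n A - ζ * PowerSeries.coeff (n + 1) A := by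
      rw [hB', map_sub, PowerSeries.coeff_succ_X_mul, PowerSeries.coeff_C_mul]
    have h2 : ζ * PowerSeries.coeff (n + 1) A
        = PowerSeries.coeff n A - PowerSeries.coeff (n + 1) B := by rw [this]; ring
    rw [← norm_mul, h2]
    exact (norm_sub_le _ _).trans_eq (add_comm _ _)
  have key : ∀ N, ‖ζ‖ * ∑ n ∈ Finset.range (N + 1), ‖PowerSeries.coeff n A‖ * r ^ n
      ≤ ∑ n ∈ Finset.range (N + 1), ‖PowerSeries.coeff n B‖ * r ^ n
        + r * ∑ n ∈ Finset.range N, ‖PowerSeries.coeff n A‖ * r ^ n := by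
    intro N
    induction N with
    | zero => simpa using h0.le
    | succ N ih =>
      rw [Finset.sum_range_succ _ (N + 1), Finset.sum_range_succ _ (N + 1),
        Finset.sum_range_succ (fun n => ‖PowerSeries.coeff n A‖ * r ^ n) N] at *
      have := mul_le_mul_of_nonneg_right (hs N) (pow_nonneg hr (N + 1))
      rw [pow_succ] at *
      nlinarith
  refine summable_of_sum_range_le (c := (∑' n, ‖PowerSeries.coeff n B‖ * r ^ n) / (‖ζ‖ - r))
    (fun n => by positivity) fun N => ?_
  rw [le_div_iff₀ (by linarith)]
  have h1 := key N
  have h2 : ∑ n ∈ Finset.range (N + 1), ‖PowerSeries.coeff n B‖ * r ^ n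
      ≤ ∑' n, ‖PowerSeries.coeff n B‖ * r ^ n :=
    h.sum_le_tsum _ fun n _ => by positivity
  have h3 : ∑ n ∈ Finset.range N, ‖PowerSeries.coeff n A‖ * r ^ n
      ≤ ∑ n ∈ Finset.range (N + 1), ‖PowerSeries.coeff n A‖ * r ^ n :=
    Finset.sum_le_sum_of_subset_of_nonneg (Finset.range_mono (Nat.le_succ N))
      fun n _ _ => by positivity
  have h4 := mul_le_mul_of_nonneg_left h3 (norm_nonneg ζ)
  linarith

theorem summable_norm_coeff_polynomial (P : Polynomial ℂ) (r : ℝ) :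
    Summable fun n => ‖P.coeff n‖ * r ^ n := by
  refine summable_of_hasFiniteSupport (P.support.finite_toSet.subset fun n hn => ?_)
  rw [Function.mem_support] at hn
  simp only [Finset.mem_coe, Polynomial.mem_support_iff]
  intro h
  simp [h] at hn

/-- A quotient of polynomials whose denominator has no root in the closed disc of radius `r`
converges absolutely on that disc. -/
theorem summable_norm_coeff_of_roots {r : ℝ} (hr : 0 ≤ r) (P : Polynomial ℂ) :
    ∀ (d : ℕ) (Q : Polynomial ℂ) (A : PowerSeries ℂ), Q.natDegree = d → Q ≠ 0 →
      (∀ ζ, Q.IsRoot ζ → r < ‖ζ‖) → (Q : PowerSeries ℂ) * A = P →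
      Summable fun n => ‖PowerSeries.coeff n A‖ * r ^ n := by
  intro d
  induction d with
  | zero =>
    intro Q A hd hQ _ h
    obtain ⟨c, rfl⟩ := Polynomial.natDegree_eq_zero.1 hd
    have hc : c ≠ 0 := fun h => hQ (by simp [h])
    have hA : A = ((Polynomial.C c⁻¹ * P : Polynomial ℂ) : PowerSeries ℂ) := by
      rw [Polynomial.coe_mul, ← h, ← mul_assoc, ← Polynomial.coe_mul, ← Polynomial.C_mul,
        inv_mul_cancel₀ hc]
      simp
    rw [hA]
    simpa only [Polynomial.coeff_coe] using summable_norm_coeff_polynomial (Polynomial.C c⁻¹ * P) r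
  | succ d ih =>
    intro Q A hd hQ hroot h
    obtain ⟨ζ, hζ⟩ := IsAlgClosed.exists_root Q (by
      rw [Polynomial.degree_eq_natDegree hQ, hd]; exact_mod_cast Nat.succ_ne_zero d)
    obtain ⟨Q₁, rfl⟩ := Polynomial.dvd_iff_isRoot.2 hζ
    refine summable_norm_coeff_of_X_sub_C_mul hr (hroot ζ hζ) (ih Q₁ _ ?_ ?_ ?_ ?_)
    · rw [Polynomial.natDegree_mul (Polynomial.X_sub_C_ne_zero ζ) (right_ne_zero_of_mul hQ),
        Polynomial.natDegree_X_sub_C] at hd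
      omega
    · exact right_ne_zero_of_mul hQ
    · intro ξ hξ
      exact hroot ξ (by
        rw [Polynomial.IsRoot, Polynomial.eval_mul, hξ.eq_zero, mul_zero])
    · rw [← h, Polynomial.coe_mul]; ring

theorem hasSum_polynomial_eval (P : Polynomial ℂ) (z : ℂ) :
    HasSum (fun n => P.coeff n * z ^ n) (P.eval z) := by
  rw [Polynomial.eval_eq_sum, Polynomial.sum]
  refine hasSum_sum_of_ne_finset_zero fun n hn => ?_
  rw [Polynomial.notMem_support_iff.1 hn, zero_mul]

theorem eval_eq_eval_mul_tsum {P Q : Polynomial ℂ} {A : PowerSeries ℂ}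
    (h : (Q : PowerSeries ℂ) * A = P) {z : ℂ}
    (hA : Summable fun n => ‖PowerSeries.coeff n A‖ * ‖z‖ ^ n) :
    P.eval z = Q.eval z * ∑' n, PowerSeries.coeff n A * z ^ n := by
  have hA' : Summable fun n => ‖PowerSeries.coeff n A * z ^ n‖ := by simpa using hA
  have hQ' : Summable fun n => ‖Q.coeff n * z ^ n‖ := by
    simpa using summable_norm_coeff_polynomial Q ‖z‖
  rw [← (hasSum_polynomial_eval P z).tsum_eq, ← (hasSum_polynomial_eval Q z).tsum_eq,
    tsum_mul_tsum_eq_tsum_sum_antidiagonal_of_summable_norm hQ' hA']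
  refine tsum_congr fun n => ?_
  rw [← Polynomial.coeff_coe, ← h, PowerSeries.coeff_mul, Finset.sum_mul]
  refine Finset.sum_congr rfl fun ij hij => ?_
  rw [← Finset.HasAntidiagonal.mem_antidiagonal.1 hij, Polynomial.coeff_coe, pow_add]
  ring

theorem IsRationalSeries.exists_isCoprime {A : PowerSeries ℂ} (hA : IsRationalSeries A) :
    ∃ P Q : Polynomial ℂ, Q ≠ 0 ∧ IsCoprime Q P ∧ (Q : PowerSeries ℂ) * A = P := by
  obtain ⟨P₀, Q₀, hQ₀, h₀⟩ := hA
  obtain ⟨Q, P, D, hcop, rfl, rfl⟩ :=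
    UniqueFactorizationMonoid.exists_reduced_factors Q₀ hQ₀ P₀
  refine ⟨P, Q, right_ne_zero_of_mul hQ₀, hcop.isCoprime, ?_⟩
  have hD : (D : PowerSeries ℂ) ≠ 0 := by
    rw [Ne, Polynomial.coe_eq_zero_iff]; exact left_ne_zero_of_mul hQ₀
  refine mul_left_cancel₀ hD ?_
  rw [← mul_assoc, ← Polynomial.coe_mul, h₀, Polynomial.coe_mul]

theorem Polynomial.exists_lt_norm_of_isRoot {Q : Polynomial ℂ} (hQ : Q ≠ 0) {R : ℝ}
    (hroot : ∀ ζ, Q.IsRoot ζ → R < ‖ζ‖) : ∃ r, R < r ∧ ∀ ζ, Q.IsRoot ζ → r < ‖ζ‖ := by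
  have hev : ∀ᶠ r in 𝓝[>] R, ∀ ζ ∈ Q.roots.toFinset, r < ‖ζ‖ := by
    rw [Filter.eventually_all_finset]
    intro ζ hζ
    rw [Multiset.mem_toFinset, Polynomial.mem_roots hQ] at hζ
    exact mem_nhdsWithin_of_mem_nhds (gt_mem_nhds (hroot ζ hζ))
  obtain ⟨r, hr, hRr⟩ := (hev.and self_mem_nhdsWithin).exists
  exact ⟨r, hRr, fun ζ hζ => hr ζ (by rwa [Multiset.mem_toFinset, Polynomial.mem_roots hQ])⟩

theorem IsRationalSeries.exists_pos_summable {A : PowerSeries ℂ} (hA : IsRationalSeries A) :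
    ∃ r : ℝ, 0 < r ∧ Summable fun n => ‖PowerSeries.coeff n A‖ * r ^ n := by
  obtain ⟨P, Q, hQ, hcop, h⟩ := hA.exists_isCoprime
  have hroot : ∀ ζ, Q.IsRoot ζ → 0 < ‖ζ‖ := by
    rintro ζ hζ
    rw [norm_pos_iff]
    rintro rfl
    have hP : P.eval 0 = 0 := by
      have h0 := congrArg PowerSeries.constantCoeff h
      rw [map_mul, Polynomial.constantCoeff_coe, Polynomial.constantCoeff_coe,
        Polynomial.coeff_zero_eq_eval_zero, Polynomial.coeff_zero_eq_eval_zero,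
        hζ.eq_zero, zero_mul] at h0
      exact h0.symm
    obtain ⟨u, v, huv⟩ := hcop
    have := congrArg (Polynomial.eval 0) huv
    simp [hP, hζ.eq_zero] at this
  obtain ⟨r, hr0, hr⟩ := Polynomial.exists_lt_norm_of_isRoot hQ hroot
  exact ⟨r, hr0, summable_norm_coeff_of_roots hr0.le P _ Q A rfl hQ hr h⟩

/-- A rational power series which grows more slowly than a simple pole when approaching the circle
of radius `R` converges absolutely on a strictly larger disc. -/
theorem exists_summable_of_rational {A : PowerSeries ℂ} (hA : IsRationalSeries A) {R : ℝ}
    (hR : 0 < R)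
    (hsum : ∀ r, 0 ≤ r → r < R → Summable fun n => ‖PowerSeries.coeff n A‖ * r ^ n)
    (hlim : Tendsto (fun r => (R - r) * ∑' n, ‖PowerSeries.coeff n A‖ * r ^ n)
      (𝓝[<] R) (𝓝 0)) :
    ∃ r, R < r ∧ Summable fun n => ‖PowerSeries.coeff n A‖ * r ^ n := by
  obtain ⟨P, Q, hQ, hcop, h⟩ := hA.exists_isCoprime
  have hroot : ∀ ζ, Q.IsRoot ζ → R < ‖ζ‖ := by
    intro ζ hζ
    by_contra! hle
    obtain ⟨Q₁, rfl⟩ := Polynomial.dvd_iff_isRoot.2 hζ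
    -- approach `ζ` along the ray through it: the simple zero of `Q` absorbs the growth of `A`
    have hz : Tendsto (fun r : ℝ => ((r / R : ℝ) : ℂ) * ζ) (𝓝[<] R) (𝓝 ζ) := by
      have : Continuous fun r : ℝ => ((r / R : ℝ) : ℂ) * ζ := by fun_prop
      have h2 := (this.tendsto R).mono_left (nhdsWithin_le_nhds (s := Set.Iio R))
      simpa [hR.ne'] using h2
    have hP : Tendsto (fun r : ℝ => ‖P.eval (((r / R : ℝ) : ℂ) * ζ)‖) (𝓝[<] R)
        (𝓝 ‖P.eval ζ‖) := ((P.continuous.tendsto ζ).comp hz).norm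
    have hQ₁ : Tendsto (fun r : ℝ => ‖Q₁.eval (((r / R : ℝ) : ℂ) * ζ)‖ *
        ((R - r) * ∑' n, ‖PowerSeries.coeff n A‖ * r ^ n)) (𝓝[<] R) (𝓝 0) := by
      simpa using (((Q₁.continuous.tendsto ζ).comp hz).norm).mul hlim
    have hP0 : ‖P.eval ζ‖ ≤ 0 := by
      refine le_of_tendsto_of_tendsto hP hQ₁ ?_
      filter_upwards [self_mem_nhdsWithin, mem_nhdsWithin_of_mem_nhds (lt_mem_nhds hR)]
        with r hrR hr0
      simp only [Set.mem_Iio] at hrR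
      set z : ℂ := ((r / R : ℝ) : ℂ) * ζ with hzdef
      have hzr : ‖z‖ ≤ r := by
        rw [hzdef, norm_mul, Complex.norm_real, Real.norm_of_nonneg (by positivity),
          div_mul_eq_mul_div, div_le_iff₀ hR]
        gcongr
      have hzζ : ‖z - ζ‖ ≤ R - r := by
        have : z - ζ = ((r / R - 1 : ℝ) : ℂ) * ζ := by rw [hzdef]; push_cast; ring
        have h1 : r / R ≤ 1 := by rw [div_le_one hR]; exact hrR.le
        rw [this, norm_mul, Complex.norm_real, Real.norm_of_nonpos (by linarith)]
        calc -(r / R - 1) * ‖ζ‖ ≤ -(r / R - 1) * R := by gcongr; linarith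
          _ = R - r := by field_simp; ring
      have hs := hsum r hr0.le hrR
      have hsz : Summable fun n => ‖PowerSeries.coeff n A‖ * ‖z‖ ^ n :=
        hs.of_nonneg_of_le (fun n => by positivity) fun n => by gcongr
      have hAz : ‖∑' n, PowerSeries.coeff n A * z ^ n‖
          ≤ ∑' n, ‖PowerSeries.coeff n A‖ * r ^ n := by
        refine tsum_of_norm_bounded hs.hasSum fun n => ?_
        rw [norm_mul, norm_pow]
        gcongr
      rw [eval_eq_eval_mul_tsum h hsz, Polynomial.eval_mul, norm_mul, norm_mul]
      simp only [Polynomial.eval_sub, Polynomial.eval_X, Polynomial.eval_C]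
      calc ‖z - ζ‖ * ‖Q₁.eval z‖ * ‖∑' n, PowerSeries.coeff n A * z ^ n‖
          ≤ (R - r) * ‖Q₁.eval z‖ * ∑' n, ‖PowerSeries.coeff n A‖ * r ^ n := by gcongr
        _ = _ := by ring
    have hPζ : P.eval ζ = 0 := norm_le_zero_iff.1 hP0
    obtain ⟨u, v, huv⟩ := hcop
    have := congrArg (Polynomial.eval ζ) huv
    simp [hPζ] at this
  -- the finitely many roots stay away from the closed disc of radius `R`
  obtain ⟨r, hRr, hr⟩ := Polynomial.exists_lt_norm_of_isRoot hQ hroot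
  exact ⟨r, hRr, summable_norm_coeff_of_roots (hR.trans hRr).le P _ Q A rfl hQ hr h⟩

/-! ### From the inequalities to nonrationality -/

theorem natCast_mul_sub_mul_pow_le {r R : ℝ} (hr : 0 ≤ r) (hrR : r ≤ R) (n : ℕ) :
    n * (R - r) * r ^ n ≤ R * R ^ n := by
  -- the sharper bound makes the induction work
  suffices h : n * (R - r) * r ^ n ≤ R * (R ^ n - r ^ n) by
    have : 0 ≤ R * r ^ n := mul_nonneg (hr.trans hrR) (pow_nonneg hr n)
    linarith
  induction n with
  | zero => simp
  | succ n ih =>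
    have h1 : 0 ≤ r ^ n := pow_nonneg hr n
    have h2 : r ^ n ≤ R ^ n := pow_le_pow_left₀ hr hrR n
    have h3 := mul_le_mul_of_nonneg_left ih hr
    have h4 : 0 ≤ (R - r) * (R ^ n - r ^ n) := mul_nonneg (by linarith) (by linarith)
    have h5 : 0 ≤ (R - r) * (R - r) * r ^ n :=
      mul_nonneg (mul_nonneg (by linarith) (by linarith)) h1
    have h6 := mul_nonneg (hr.trans hrR) h4
    have h7 := mul_nonneg (sub_nonneg.2 hrR) (mul_nonneg (hr.trans hrR) h1)
    push_cast
    rw [pow_succ, pow_succ]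
    nlinarith [mul_nonneg (sub_nonneg.2 hrR) (mul_nonneg (sub_nonneg.2 hrR) h1)]

/-- The inequality `z S(z)² ≤ S(z)` bounds `S`. -/
theorem tsum_le_inv_of_convolution_le {s : ℕ → ℕ} (h0 : s 0 = 1)
    (h2 : ∀ n, ∑ ij ∈ Finset.HasAntidiagonal.antidiagonal n, s ij.1 * s ij.2 ≤ s (n + 1))
    {r : ℝ} (hr : 0 < r)
    (hs : Summable fun n => (s n : ℝ) * r ^ n) : ∑' n, (s n : ℝ) * r ^ n ≤ r⁻¹ := by
  set F := ∑' n, (s n : ℝ) * r ^ n with hF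
  have hsn : Summable fun n => ‖(s n : ℝ) * r ^ n‖ := hs.norm
  have hsq : F * F = ∑' n, ∑ ij ∈ Finset.HasAntidiagonal.antidiagonal n,
      ((s ij.1 : ℝ) * r ^ ij.1) * ((s ij.2 : ℝ) * r ^ ij.2) :=
    tsum_mul_tsum_eq_tsum_sum_antidiagonal_of_summable_norm hsn hsn
  have hF1 : F = 1 + ∑' n, (s (n + 1) : ℝ) * r ^ (n + 1) := by
    rw [hF, hs.tsum_eq_zero_add]; simp [h0]
  have hs1 : Summable fun n => (s (n + 1) : ℝ) * r ^ (n + 1) :=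
    (summable_nat_add_iff 1).2 hs
  have hpos : 0 < F := by
    have : 0 ≤ ∑' n, (s (n + 1) : ℝ) * r ^ (n + 1) := tsum_nonneg fun n => by positivity
    linarith
  have hle : r * (F * F) ≤ F := by
    rw [hsq, ← tsum_mul_left]
    refine le_trans (Summable.tsum_le_tsum (fun n => ?_)
      ((summable_norm_sum_mul_antidiagonal_of_summable_norm hsn hsn).of_norm.mul_left r) hs1)
      (by linarith)
    calc r * ∑ ij ∈ Finset.HasAntidiagonal.antidiagonal n,
          ((s ij.1 : ℝ) * r ^ ij.1) * ((s ij.2 : ℝ) * r ^ ij.2)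
        = ((∑ ij ∈ Finset.HasAntidiagonal.antidiagonal n, s ij.1 * s ij.2 : ℕ) : ℝ)
          * r ^ (n + 1) := by
          push_cast
          rw [Finset.mul_sum, Finset.sum_mul]
          refine Finset.sum_congr rfl fun ij hij => ?_
          rw [← Finset.HasAntidiagonal.mem_antidiagonal.1 hij]; ring
      _ ≤ (s (n + 1) : ℝ) * r ^ (n + 1) := by
          gcongr; exact_mod_cast h2 n
  rw [le_inv_comm₀ hpos hr, ← one_div, le_div_iff₀ hpos]
  nlinarith

/-- The analytic core. Here `s` plays the part of the numbers of avoiders and `a` that of the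
numbers of permutations with exactly one copy. -/
theorem not_isRationalSeries_of_bounds {a s : ℕ → ℕ} (k : ℕ) (h0 : s 0 = 1)
    (h1 : ∀ n, a n ≤ n * s n)
    (h2 : ∀ n, ∑ ij ∈ Finset.HasAntidiagonal.antidiagonal n, s ij.1 * s ij.2 ≤ s (n + 1))
    (h3 : ∀ n, s n ≤ a (k + n)) :
    ¬ IsRationalSeries (PowerSeries.mk fun n => (a n : ℂ)) := by
  intro hrat
  have hspos : ∀ n, 1 ≤ s n := by
    intro n
    induction n with
    | zero => exact h0.ge
    | succ n ih =>
      refine le_trans ?_ (h2 n)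
      refine le_trans ?_ (Finset.single_le_sum (f := fun ij : ℕ × ℕ => s ij.1 * s ij.2)
        (fun _ _ => Nat.zero_le _) (show (n, 0) ∈ Finset.HasAntidiagonal.antidiagonal n by simp))
      simpa [h0] using ih
  set T : Set ℝ := {r | 0 ≤ r ∧ Summable fun n => (a n : ℝ) * r ^ n} with hT
  have hbdd : ∀ r ∈ T, r ≤ 1 := by
    rintro r ⟨hr, hs⟩
    by_contra! hlt
    have h4 := ((summable_nat_add_iff k).2 hs).tendsto_atTop_zero
    refine absurd (ge_of_tendsto' h4 fun n => (?_ : (1 : ℝ) ≤ _)) (by norm_num)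
    have h5 : (1 : ℝ) ≤ a (n + k) := by
      have := (hspos n).trans (h3 n)
      rw [add_comm] at this
      exact_mod_cast this
    exact one_le_mul_of_one_le_of_one_le h5 (one_le_pow₀ hlt.le)
  -- a rational series has a positive radius of convergence
  obtain ⟨ε, hε, hεT⟩ : ∃ ε, 0 < ε ∧ ε ∈ T := by
    obtain ⟨ε, hε, hs⟩ := hrat.exists_pos_summable
    exact ⟨ε, hε, hε.le, by simpa using hs⟩
  set R := sSup T with hRdef
  have hTb : BddAbove T := ⟨1, hbdd⟩
  have hR : 0 < R := hε.trans_le (le_csSup hTb hεT)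
  have hsum : ∀ r, 0 ≤ r → r < R → Summable fun n => (a n : ℝ) * r ^ n := by
    intro r hr hrR
    obtain ⟨t, ⟨ht0, ht⟩, hrt⟩ := exists_lt_of_lt_csSup ⟨ε, hεT⟩ hrR
    exact ht.of_nonneg_of_le (fun n => by positivity) fun n => by gcongr
  have hsums : ∀ r, 0 < r → r < R → Summable fun n => (s n : ℝ) * r ^ n := by
    intro r hr hrR
    have h4 := ((summable_nat_add_iff k).2 (hsum r hr.le hrR)).mul_left (r ^ k)⁻¹
    refine h4.of_nonneg_of_le (fun n => by positivity) fun n => ?_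
    have h5 : (s n : ℝ) ≤ a (n + k) := by rw [add_comm]; exact_mod_cast h3 n
    calc (s n : ℝ) * r ^ n ≤ a (n + k) * r ^ n := by gcongr
      _ = (r ^ k)⁻¹ * (a (n + k) * r ^ (n + k)) := by rw [pow_add]; field_simp
  -- the bound `r⁻¹` on the partial sums persists in the limit `r → R`
  have hRs : Summable fun n => (s n : ℝ) * R ^ n := by
    refine summable_of_sum_range_le (c := R⁻¹) (fun n => by positivity) fun N => ?_
    have hc : Continuous fun r : ℝ => ∑ n ∈ Finset.range N, (s n : ℝ) * r ^ n := by fun_prop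
    refine le_of_tendsto_of_tendsto ((hc.tendsto R).mono_left
      (nhdsWithin_le_nhds (s := Set.Iio R)))
      ((tendsto_inv₀ hR.ne').mono_left nhdsWithin_le_nhds) ?_
    filter_upwards [self_mem_nhdsWithin, mem_nhdsWithin_of_mem_nhds (lt_mem_nhds hR)]
      with r hrR hr0
    have hs := hsums r hr0 hrR
    exact (hs.sum_le_tsum _ fun n _ => by positivity).trans
      (tsum_le_inv_of_convolution_le h0 h2 hr0 hs)
  have hlim : Tendsto (fun r => ∑' n, (R - r) * ((a n : ℝ) * r ^ n)) (𝓝[<] R) (𝓝 0) := by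
    have h4 := tendsto_tsum_of_dominated_convergence (𝓕 := 𝓝[<] R)
      (f := fun (r : ℝ) n => (R - r) * ((a n : ℝ) * r ^ n)) (g := fun _ => (0 : ℝ))
      (bound := fun n => R * ((s n : ℝ) * R ^ n)) (hRs.mul_left R) ?_ ?_
    · simpa using h4
    · intro n
      have hc : Continuous fun r : ℝ => (R - r) * ((a n : ℝ) * r ^ n) := by fun_prop
      simpa using (hc.tendsto R).mono_left (nhdsWithin_le_nhds (s := Set.Iio R))
    · filter_upwards [self_mem_nhdsWithin, mem_nhdsWithin_of_mem_nhds (lt_mem_nhds hR)]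
        with r hrR hr0 n
      have hrR' : 0 ≤ R - r := sub_nonneg.2 (le_of_lt hrR)
      rw [Real.norm_of_nonneg (by positivity)]
      have h5 : (a n : ℝ) ≤ n * s n := by exact_mod_cast h1 n
      have h6 := natCast_mul_sub_mul_pow_le hr0.le (le_of_lt hrR) n
      calc (R - r) * ((a n : ℝ) * r ^ n) ≤ (R - r) * ((n * s n : ℝ) * r ^ n) := by gcongr
        _ = s n * (n * (R - r) * r ^ n) := by ring
        _ ≤ s n * (R * R ^ n) := by gcongr
        _ = R * (s n * R ^ n) := by ring
  obtain ⟨r, hRr, hr⟩ := exists_summable_of_rational hrat hR (by simpa using hsum)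
    (by simpa [tsum_mul_left] using hlim)
  exact absurd (le_csSup hTb (⟨(hR.trans hRr).le, by simpa using hr⟩ : r ∈ T)) (not_le.2 hRr)

/-! ### Copies of a pattern -/

/-- Deciding membership in `copies` needs only one direction of the equivalence. -/
theorem ofStrictMono_mem_copies {m n : ℕ} {q : Equiv.Perm (Fin m)} {p : Equiv.Perm (Fin n)}
    (f : Fin m → Fin n) (hf : StrictMono f) (h : ∀ r s, q r < q s → p (f r) < p (f s)) :
    OrderEmbedding.ofStrictMono f hf ∈ copies q p := by
  intro r s
  rw [OrderEmbedding.coe_ofStrictMono]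
  refine ⟨fun hlt => ?_, h r s⟩
  by_contra! hle
  rcases hle.lt_or_eq with hlt' | heq
  · exact lt_asymm hlt (h s r hlt')
  · rw [q.injective heq] at hlt
    exact lt_irrefl _ hlt

section

variable {l : ℕ} {q : Equiv.Perm (Fin (l + 3))}

/-- A sequence of positions carrying the pattern of `q` without its leading maximum is completed to
a copy of `q` by any earlier and larger entry. -/
theorem exists_mem_copies_of_tail (hq : ∀ r s, r.val < 2 → r < s → q s < q r) {n : ℕ}
    {p : Equiv.Perm (Fin n)} (f : Fin (l + 3) → Fin n) {x : Fin n} (hx : x < f 1)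
    (hpx : p (f 1) < p x) (hf : ∀ r s, 0 < r → r < s → f r < f s)
    (h : ∀ r s, 0 < r → 0 < s → q r < q s → p (f r) < p (f s)) :
    ∃ e ∈ copies q p, e 0 = x ∧ ∀ r, 0 < r → e r = f r := by
  have h01 : (0 : Fin (l + 3)) < 1 := by simp
  have hf1 : ∀ r, 0 < r → x < f r := by
    intro r hr
    rcases eq_or_ne r 1 with rfl | hr1
    · exact hx
    · refine hx.trans (hf 1 r h01 ?_)
      rw [Fin.lt_def] at *
      have : r.val ≠ 1 := fun h => hr1 (Fin.ext h)
      simp at *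
      omega
  have hp1 : ∀ r, 0 < r → p (f r) < p x := by
    intro r hr
    rcases eq_or_ne r 1 with rfl | hr1
    · exact hpx
    · refine (h r 1 hr h01 (hq 1 r (by simp) ?_)).trans hpx
      rw [Fin.lt_def] at *
      have : r.val ≠ 1 := fun h => hr1 (Fin.ext h)
      simp at *
      omega
  have hpos : ∀ r : Fin (l + 3), r ≠ 0 → 0 < r := fun r hr => Fin.pos_iff_ne_zero.2 hr
  set g : Fin (l + 3) → Fin n := fun r => if r = 0 then x else f r with hg
  have hg0 : g 0 = x := if_pos rfl
  have hgr : ∀ r, 0 < r → g r = f r := fun r hr => if_neg hr.ne'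
  have hmono : StrictMono g := by
    intro r s hrs
    have hs : 0 < s := (Fin.zero_le r).trans_lt hrs
    rcases eq_or_ne r 0 with rfl | hr
    · rw [hg0, hgr s hs]; exact hf1 s hs
    · rw [hgr r (hpos r hr), hgr s hs]; exact hf r s (hpos r hr) hrs
  refine ⟨_, ofStrictMono_mem_copies g hmono ?_, hg0, hgr⟩
  intro r s hrs
  rcases eq_or_ne s 0 with rfl | hs
  · have hr : r ≠ 0 := by rintro rfl; exact lt_irrefl _ hrs
    rw [hg0, hgr r (hpos r hr)]; exact hp1 r (hpos r hr)
  · rcases eq_or_ne r 0 with rfl | hr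
    · exact absurd hrs (hq 0 s (by simp) (hpos s hs)).asymm
    · rw [hgr r (hpos r hr), hgr s (hpos s hs)]
      exact h r s (hpos r hr) (hpos s hs) hrs

/-! ### One copy against avoidance -/

/-- In a permutation with a single copy `c b a …` of `q`, the entry `c` is the only one that
precedes and exceeds `b`. -/
theorem eq_of_lt_of_copies_eq_singleton (hq : ∀ r s, r.val < 2 → r < s → q s < q r) {n : ℕ}
    {p : Equiv.Perm (Fin n)} {e : Fin (l + 3) ↪o Fin n} (he : copies q p = {e}) {x : Fin n}
    (hx : x < e 1) (hpx : p (e 1) < p x) : x = e 0 := by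
  have hmem : e ∈ copies q p := by rw [he]; rfl
  obtain ⟨e', he', h0, -⟩ := exists_mem_copies_of_tail hq e hx hpx
    (fun r s _ h => e.strictMono h) (fun r s _ _ h => (hmem r s).2 h)
  rw [he, Set.mem_singleton_iff] at he'
  rw [← h0, he']

/-- Exchanging the first two entries of the only copy of `q` leaves no copy. -/
theorem copies_swap_eq_empty (hq : ∀ r s, r.val < 2 → r < s → q s < q r) {n : ℕ}
    {p : Equiv.Perm (Fin n)} {e : Fin (l + 3) ↪o Fin n} (he : copies q p = {e}) :
    copies q (p * Equiv.swap (e 0) (e 1)) = ∅ := by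
  have hmem : e ∈ copies q p := by rw [he]; rfl
  have h01 : e 0 < e 1 := e.strictMono (by simp)
  have hcb : p (e 1) < p (e 0) := (hmem 1 0).2 (hq 0 1 (by simp) (by simp))
  have honly := fun x => eq_of_lt_of_copies_eq_singleton (x := x) hq he
  set w := p * Equiv.swap (e 0) (e 1) with hw
  have hw0 : w (e 0) = p (e 1) := by simp [hw]
  have hw1 : w (e 1) = p (e 0) := by simp [hw]
  have hwx : ∀ x, x ≠ e 0 → x ≠ e 1 → w x = p x := by
    intro x h0 h1
    simp [hw, Equiv.swap_apply_of_ne_of_ne h0 h1]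
  -- both exchanged entries are left-to-right maxima
  have hmax0 : ∀ x, x < e 0 → w x < w (e 0) := by
    intro x hx
    rw [hw0, hwx x hx.ne (hx.trans h01).ne]
    by_contra! hle
    have hne : p (e 1) ≠ p x := fun h => (hx.trans h01).ne' (p.injective h)
    exact hx.ne (honly x (hx.trans h01) (lt_of_le_of_ne hle hne))
  have hmax1 : ∀ x, x < e 1 → w x < w (e 1) := by
    intro x hx
    rcases eq_or_ne x (e 0) with rfl | hx0
    · rw [hw0, hw1]; exact hcb
    · rw [hw1, hwx x hx0 hx.ne]
      by_contra! hle
      exact hx0 (honly x hx (hcb.trans_le hle))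
  rw [Set.eq_empty_iff_forall_notMem]
  intro i hi
  have hfirst : ∀ r, 0 < r → i r ≠ e 0 ∧ i r ≠ e 1 := by
    intro r hr
    have h1 : i 0 < i r := i.strictMono hr
    have h2 : w (i r) < w (i 0) := (hi r 0).2 (hq 0 r (by simp) hr)
    constructor
    · intro h; rw [h] at h1 h2; exact lt_asymm h2 (hmax0 _ h1)
    · intro h; rw [h] at h1 h2; exact lt_asymm h2 (hmax1 _ h1)
  have htail : ∀ r, 0 < r → w (i r) = p (i r) := fun r hr =>
    hwx _ (hfirst r hr).1 (hfirst r hr).2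
  have hlt1 : i 0 < i 1 := i.strictMono (by simp)
  have hgt1 : w (i 1) < w (i 0) := (hi 1 0).2 (hq 0 1 (by simp) (by simp))
  -- in `p`, the same tail completes to a copy that misses the position of `b`
  obtain ⟨x, hx, hpx⟩ : ∃ x, x < i 1 ∧ p (i 1) < p x := by
    rw [htail 1 (by simp)] at hgt1
    rcases eq_or_ne (i 0) (e 0) with h0 | h0
    · rw [h0] at hlt1 hgt1
      exact ⟨e 0, hlt1, by rw [hw0] at hgt1; exact hgt1.trans hcb⟩
    rcases eq_or_ne (i 0) (e 1) with h1 | h1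
    · rw [h1] at hlt1 hgt1
      exact ⟨e 0, h01.trans hlt1, by rwa [hw1] at hgt1⟩
    · exact ⟨i 0, hlt1, by rwa [hwx _ h0 h1] at hgt1⟩
  obtain ⟨e', he', -, htl⟩ := exists_mem_copies_of_tail hq i hx hpx
    (fun r s _ h => i.strictMono h) (fun r s hr hs h => by
      rw [← htail r hr, ← htail s hs]; exact (hi r s).2 h)
  rw [he, Set.mem_singleton_iff] at he'
  exact (hfirst 1 (by simp)).2 (by rw [← htl 1 (by simp), he'])

/-- Number of permutations with one copy versus number of avoiders: exchanging the first two
entries `c b` of the copy is undone once the position of `b` is known, because `b` then becomes the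
largest entry before `c`. -/
theorem numPermsWithCopies_one_le (hq : ∀ r s, r.val < 2 → r < s → q s < q r) (n : ℕ) :
    numPermsWithCopies q 1 n ≤ n * numPermsWithCopies q 0 n := by
  have hE : ∀ p : {p : Equiv.Perm (Fin n) | (copies q p).ncard = 1}, ∃ e, copies q p.1 = {e} :=
    fun p => Set.ncard_eq_one.1 p.2
  choose E hE using hE
  have hzero : ∀ p : Equiv.Perm (Fin n), (copies q p).ncard = 0 ↔ copies q p = ∅ := fun p =>
    Set.ncard_eq_zero (Set.toFinite _)
  let F : {p : Equiv.Perm (Fin n) | (copies q p).ncard = 1} →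
      Fin n × {p : Equiv.Perm (Fin n) | (copies q p).ncard = 0} := fun p =>
    (E p 1, ⟨p.1 * Equiv.swap (E p 0) (E p 1), (hzero _).2 (copies_swap_eq_empty hq (hE p))⟩)
  have hF : Function.Injective F := by
    intro p p' h
    have h1 : E p 1 = E p' 1 := congrArg Prod.fst h
    have h2 : p.1 * Equiv.swap (E p 0) (E p 1) = p'.1 * Equiv.swap (E p' 0) (E p' 1) :=
      congrArg (fun x => x.2.1) h
    have key : ∀ p : {p : Equiv.Perm (Fin n) | (copies q p).ncard = 1}, ∀ x, x < E p 1 →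
        (p.1 * Equiv.swap (E p 0) (E p 1)) x
          ≤ (p.1 * Equiv.swap (E p 0) (E p 1)) (E p 0) := by
      intro p x hx
      rcases eq_or_ne x (E p 0) with rfl | hx0
      · exact le_rfl
      · rw [Equiv.Perm.mul_apply, Equiv.Perm.mul_apply, Equiv.swap_apply_left,
          Equiv.swap_apply_of_ne_of_ne hx0 hx.ne]
        by_contra! hlt
        exact hx0 (eq_of_lt_of_copies_eq_singleton hq (hE p) hx hlt)
    have h01 : ∀ p, E p 0 < E p 1 := fun p => (E p).strictMono (by simp)
    have h0 : E p 0 = E p' 0 := by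
      refine (p.1 * Equiv.swap (E p 0) (E p 1)).injective (le_antisymm ?_ ?_)
      · have := key p' (E p 0) (h1 ▸ h01 p)
        rwa [← h2] at this
      · exact key p (E p' 0) (h1 ▸ h01 p')
    rw [h0, h1] at h2
    exact Subtype.ext (mul_right_cancel h2)
  have := Nat.card_le_card_of_injective F hF
  rw [Nat.card_prod, Nat.card_fin] at this
  exact this

end

/-! ### Direct sums -/

/-- The direct sum of permutations: `σ` below and to the left of `τ`. -/
def directSum {a b : ℕ} (σ : Equiv.Perm (Fin a)) (τ : Equiv.Perm (Fin b)) :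
    Equiv.Perm (Fin (a + b)) :=
  finSumFinEquiv.symm.trans ((Equiv.sumCongr σ τ).trans finSumFinEquiv)

theorem directSum_castAdd {a b : ℕ} (σ : Equiv.Perm (Fin a)) (τ : Equiv.Perm (Fin b))
    (i : Fin a) : directSum σ τ (Fin.castAdd b i) = Fin.castAdd b (σ i) := by
  simp [directSum]

theorem directSum_natAdd {a b : ℕ} (σ : Equiv.Perm (Fin a)) (τ : Equiv.Perm (Fin b))
    (i : Fin b) : directSum σ τ (Fin.natAdd a i) = Fin.natAdd a (τ i) := by
  simp [directSum]

theorem directSum_injective {a b : ℕ} : Function.Injective fun x : Equiv.Perm (Fin a) ×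
    Equiv.Perm (Fin b) => directSum x.1 x.2 := by
  rintro ⟨σ, τ⟩ ⟨σ', τ'⟩ h
  have h' : directSum σ τ = directSum σ' τ' := h
  refine Prod.ext (Equiv.ext fun i => ?_) (Equiv.ext fun i => ?_)
  · have := directSum_castAdd σ τ i
    rw [h', directSum_castAdd] at this
    exact (Fin.castAdd_injective a b this).symm
  · have := directSum_natAdd σ τ i
    rw [h', directSum_natAdd] at this
    exact (Fin.natAdd_injective b a this).symm

section

variable {l : ℕ} {q : Equiv.Perm (Fin (l + 3))}

/-- A copy in a direct sum whose pattern begins with its maximum lies in one of the summands. -/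
theorem copy_directSum_cases (hq : ∀ r s, r.val < 2 → r < s → q s < q r) {a b : ℕ}
    {σ : Equiv.Perm (Fin a)} {τ : Equiv.Perm (Fin b)} {e : Fin (l + 3) ↪o Fin (a + b)}
    (he : e ∈ copies q (directSum σ τ)) :
    (∃ e' ∈ copies q σ, ∀ r, e r = Fin.castAdd b (e' r)) ∨
      ∃ e' ∈ copies q τ, ∀ r, e r = Fin.natAdd a (e' r) := by
  rcases lt_or_ge (e 0).val a with h0 | h0
  · left
    have hval : ∀ r, (directSum σ τ (e r)).val < a := by
      intro r
      have h1 : directSum σ τ (e r) ≤ directSum σ τ (e 0) := by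
        rcases eq_or_ne r 0 with rfl | hr
        · exact le_rfl
        · exact ((he r 0).2 (hq 0 r (by simp) (Fin.pos_iff_ne_zero.2 hr))).le
      refine lt_of_le_of_lt h1 ?_
      rw [show e 0 = Fin.castAdd b ⟨_, h0⟩ from rfl, directSum_castAdd]
      simp
    have hpos : ∀ r, (e r).val < a := by
      intro r
      by_contra! hle
      have h1 := hval r
      have h2 : e r = Fin.natAdd a ⟨(e r).val - a, by have := (e r).isLt; omega⟩ :=
        Fin.ext (by simp; omega)
      rw [h2, directSum_natAdd] at h1
      simp at h1
    refine ⟨OrderEmbedding.ofStrictMono (fun r => ⟨(e r).val, hpos r⟩)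
      (fun r s h => e.strictMono h), ?_, fun r => rfl⟩
    refine ofStrictMono_mem_copies _ _ fun r s h => ?_
    have h1 := (he r s).2 h
    rw [show e r = Fin.castAdd b ⟨_, hpos r⟩ from rfl,
      show e s = Fin.castAdd b ⟨_, hpos s⟩ from rfl, directSum_castAdd, directSum_castAdd] at h1
    exact h1
  · right
    have hpos : ∀ r, a ≤ (e r).val := fun r => h0.trans (e.monotone (Fin.zero_le r))
    have hlt : ∀ r, (e r).val - a < b := fun r => by
      have := (e r).isLt
      have := hpos r
      omega
    have hnat : ∀ r, e r = Fin.natAdd a ⟨(e r).val - a, hlt r⟩ := fun r =>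
      Fin.ext (by have := hpos r; simp; omega)
    refine ⟨OrderEmbedding.ofStrictMono (fun r => ⟨(e r).val - a, hlt r⟩)
      (fun r s h => ?_), ?_, hnat⟩
    · have h1 : (e r).val < (e s).val := e.strictMono h
      have := hpos r
      rw [Fin.lt_def]
      simp only
      omega
    · refine ofStrictMono_mem_copies _ _ fun r s h => ?_
      have h1 := (he r s).2 h
      rw [hnat r, hnat s, directSum_natAdd, directSum_natAdd, Fin.lt_def] at h1
      simpa using h1

theorem copies_directSum_eq_empty (hq : ∀ r s, r.val < 2 → r < s → q s < q r) {a b : ℕ}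
    {σ : Equiv.Perm (Fin a)} {τ : Equiv.Perm (Fin b)} (hσ : copies q σ = ∅)
    (hτ : copies q τ = ∅) : copies q (directSum σ τ) = ∅ := by
  rw [Set.eq_empty_iff_forall_notMem] at *
  intro e he
  rcases copy_directSum_cases hq he with ⟨e', he', -⟩ | ⟨e', he', -⟩
  · exact hσ e' he'
  · exact hτ e' he'

theorem copies_directSum_self (hq : ∀ r s, r.val < 2 → r < s → q s < q r) {b : ℕ}
    {τ : Equiv.Perm (Fin b)} (hτ : copies q τ = ∅) :
    copies q (directSum q τ) = {Fin.castAddOrderEmb b} := by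
  ext e
  rw [Set.mem_singleton_iff]
  constructor
  · intro he
    rcases copy_directSum_cases hq he with ⟨e', -, he'⟩ | ⟨e', he', -⟩
    · have hid : ⇑e' = id := e'.strictMono.eq_id
      refine RelEmbedding.ext fun r => ?_
      rw [he', hid]
      rfl
    · rw [hτ] at he'
      exact absurd he' (Set.notMem_empty _)
  · rintro rfl r s
    rw [Fin.castAddOrderEmb_apply, Fin.castAddOrderEmb_apply, directSum_castAdd,
      directSum_castAdd]
    exact Iff.rfl

theorem numPermsWithCopies_zero_le (hq : ∀ r s, r.val < 2 → r < s → q s < q r) (n : ℕ) :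
    numPermsWithCopies q 0 n ≤ numPermsWithCopies q 1 (l + 3 + n) := by
  refine Set.ncard_le_ncard_of_injOn (fun τ => directSum q τ) ?_ ?_ (Set.toFinite _)
  · intro τ hτ
    have hτ' : copies q τ = ∅ := (Set.ncard_eq_zero (Set.toFinite _)).1 hτ
    exact Set.ncard_eq_one.2 ⟨_, copies_directSum_self hq hτ'⟩
  · intro τ _ τ' _ h
    exact congrArg Prod.snd (directSum_injective (a₁ := (q, τ)) (a₂ := (q, τ')) h)

end

/-! ### Lifting to indecomposable permutations -/

/-- Position `x` carries a left-to-right maximum of `p`. -/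
def IsLRMax {m : ℕ} (p : Equiv.Perm (Fin m)) (x : Fin m) : Prop := ∀ y < x, p y < p x

/-- Each initial segment of positions attains its largest entry at a left-to-right maximum. -/
theorem exists_isLRMax_le {m : ℕ} (p : Equiv.Perm (Fin m)) (t : Fin m) :
    ∃ y ≤ t, IsLRMax p y ∧ ∀ z ≤ t, p z ≤ p y := by
  obtain ⟨y, hy, hmax⟩ := Finset.exists_max_image (Finset.Iic t) p ⟨t, Finset.mem_Iic.2 le_rfl⟩
  rw [Finset.mem_Iic] at hy
  refine ⟨y, hy, fun z hz => ?_, fun z hz => hmax z (Finset.mem_Iic.2 hz)⟩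
  exact lt_of_le_of_ne (hmax z (Finset.mem_Iic.2 (hz.le.trans hy)))
    fun h => hz.ne (p.injective h)

theorem exists_isLRMax_lt_of_not {m : ℕ} {p : Equiv.Perm (Fin m)} {z : Fin m}
    (hz : ¬ IsLRMax p z) : ∃ y < z, IsLRMax p y ∧ p z < p y := by
  obtain ⟨y, hy, hmax, hle⟩ := exists_isLRMax_le p z
  have hne : y ≠ z := by rintro rfl; exact hz hmax
  exact ⟨y, lt_of_le_of_ne hy hne, hmax,
    lt_of_le_of_ne (hle z le_rfl) fun h => hne (p.injective h).symm⟩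

open scoped Classical in
/-- The underlying map of `liftPerm p`: all values are raised by one and a new value `0` is appended,
then the values that are not left-to-right maxima are shifted cyclically, each to the next position
not carrying a left-to-right maximum, so that `0` comes first among them. -/
noncomputable def liftFun {m : ℕ} (p : Equiv.Perm (Fin m)) (x : Fin (m + 1)) : Fin (m + 1) :=
  if h : ∃ y : Fin m, y.castSucc = x ∧ IsLRMax p y then (p h.choose).succ
  else if h : (Finset.univ.filter fun y : Fin m => ¬ IsLRMax p y ∧ y.castSucc < x).Nonempty then
    (p (Finset.max' _ h)).succ
  else 0

theorem liftFun_castSucc {m : ℕ} {p : Equiv.Perm (Fin m)} {y : Fin m} (hy : IsLRMax p y) :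
    liftFun p y.castSucc = (p y).succ := by
  have h : ∃ z : Fin m, z.castSucc = y.castSucc ∧ IsLRMax p z := ⟨y, rfl, hy⟩
  rw [liftFun, dif_pos h, Fin.castSucc_injective m h.choose_spec.1]

theorem liftFun_of_not {m : ℕ} {p : Equiv.Perm (Fin m)} {x : Fin (m + 1)}
    (hx : ∀ y : Fin m, y.castSucc = x → ¬ IsLRMax p y) :
    (∃ z : Fin m, ¬ IsLRMax p z ∧ z.castSucc < x ∧
        (∀ w : Fin m, ¬ IsLRMax p w → w.castSucc < x → w ≤ z) ∧ liftFun p x = (p z).succ) ∨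
      ((∀ w : Fin m, w.castSucc < x → IsLRMax p w) ∧ liftFun p x = 0) := by
  classical
  have h1 : ¬ ∃ y : Fin m, y.castSucc = x ∧ IsLRMax p y := fun ⟨y, hy, hm⟩ => hx y hy hm
  by_cases h2 : (Finset.univ.filter fun y : Fin m => ¬ IsLRMax p y ∧ y.castSucc < x).Nonempty
  · left
    have hmem := Finset.max'_mem _ h2
    rw [Finset.mem_filter] at hmem
    refine ⟨Finset.max' _ h2, hmem.2.1, hmem.2.2, fun w hw hwx => ?_, ?_⟩
    · exact Finset.le_max' _ w (Finset.mem_filter.2 ⟨Finset.mem_univ _, hw, hwx⟩)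
    · rw [liftFun, dif_neg h1, dif_pos h2]
  · right
    refine ⟨fun w hw => ?_, by rw [liftFun, dif_neg h1, dif_neg h2]⟩
    by_contra hn
    exact h2 ⟨w, Finset.mem_filter.2 ⟨Finset.mem_univ _, hn, hw⟩⟩

theorem liftFun_injective {m : ℕ} (p : Equiv.Perm (Fin m)) :
    Function.Injective (liftFun p) := by
  have hdich : ∀ x : Fin (m + 1), (∃ y : Fin m, y.castSucc = x ∧ IsLRMax p y) ∨
      ∀ y : Fin m, y.castSucc = x → ¬ IsLRMax p y := by
    intro x
    by_cases h : ∃ y : Fin m, y.castSucc = x ∧ IsLRMax p y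
    · exact Or.inl h
    · exact Or.inr fun y hy hm => h ⟨y, hy, hm⟩
  have hne : ∀ y : Fin m, ∀ x, IsLRMax p y → (∀ y : Fin m, y.castSucc = x → ¬ IsLRMax p y) →
      liftFun p y.castSucc ≠ liftFun p x := by
    intro y x hy hx h
    rw [liftFun_castSucc hy] at h
    rcases liftFun_of_not hx with ⟨z, hz, -, -, hzx⟩ | ⟨-, h0⟩
    · rw [hzx, Fin.succ_inj] at h
      rw [← p.injective h] at hz
      exact hz hy
    · rw [h0] at h
      exact Fin.succ_ne_zero _ h
  have hlt : ∀ x x', x < x' → (∀ y : Fin m, y.castSucc = x → ¬ IsLRMax p y) →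
      (∀ y : Fin m, y.castSucc = x' → ¬ IsLRMax p y) → liftFun p x ≠ liftFun p x' := by
    intro x x' hxx hx hx' h
    have hxl : x ≠ Fin.last m := (hxx.trans_le (Fin.le_last _)).ne
    obtain ⟨w, rfl⟩ := Fin.exists_castSucc_eq.2 hxl
    have hw := hx w rfl
    rcases liftFun_of_not hx' with ⟨z', -, -, hz', h'⟩ | ⟨h', -⟩
    · have hwz := hz' w hw hxx
      rcases liftFun_of_not hx with ⟨z, -, hz, -, h''⟩ | ⟨-, h''⟩
      · rw [h', h'', Fin.succ_inj] at h
        rw [p.injective h] at hz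
        exact absurd (Fin.castSucc_lt_castSucc_iff.1 hz) (not_lt.2 hwz)
      · rw [h', h''] at h
        exact Fin.succ_ne_zero _ h.symm
    · exact hw (h' w hxx)
  intro x x' h
  rcases hdich x with ⟨y, rfl, hy⟩ | hx <;> rcases hdich x' with ⟨y', rfl, hy'⟩ | hx'
  · rw [liftFun_castSucc hy, liftFun_castSucc hy', Fin.succ_inj] at h
    rw [p.injective h]
  · exact absurd h (hne y x' hy hx')
  · exact absurd h.symm (hne y' x hy' hx)
  · rcases lt_trichotomy x x' with hl | he | hl
    · exact absurd h (hlt x x' hl hx hx')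
    · exact he
    · exact absurd h.symm (hlt x' x hl hx' hx)

/-- An indecomposable permutation of length `m + 1` built from `p`; see `liftFun`. -/
noncomputable def liftPerm {m : ℕ} (p : Equiv.Perm (Fin m)) : Equiv.Perm (Fin (m + 1)) :=
  Equiv.ofBijective (liftFun p) (Finite.injective_iff_bijective.1 (liftFun_injective p))

theorem liftPerm_apply {m : ℕ} (p : Equiv.Perm (Fin m)) (x : Fin (m + 1)) :
    liftPerm p x = liftFun p x := rfl

theorem IsLRMax.liftPerm {m : ℕ} {p : Equiv.Perm (Fin m)} {y : Fin m} (hy : IsLRMax p y) :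
    IsLRMax (liftPerm p) y.castSucc := by
  intro x hx
  rw [liftPerm_apply, liftPerm_apply, liftFun_castSucc hy]
  by_cases h : ∃ w : Fin m, w.castSucc = x ∧ IsLRMax p w
  · obtain ⟨w, rfl, hw⟩ := h
    rw [liftFun_castSucc hw, Fin.succ_lt_succ_iff]
    exact hy w (Fin.castSucc_lt_castSucc_iff.1 hx)
  · rcases liftFun_of_not (fun w hw hm => h ⟨w, hw, hm⟩) with ⟨z, -, hz, -, hzx⟩ | ⟨-, h0⟩
    · rw [hzx, Fin.succ_lt_succ_iff]
      exact hy z (Fin.castSucc_lt_castSucc_iff.1 (hz.trans hx))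
    · rw [h0]
      exact Fin.succ_pos _

theorem isLRMax_liftPerm_iff {m : ℕ} (hm : 0 < m) {p : Equiv.Perm (Fin m)} {x : Fin (m + 1)} :
    IsLRMax (liftPerm p) x ↔ ∃ y : Fin m, y.castSucc = x ∧ IsLRMax p y := by
  constructor
  · intro hx
    by_contra h
    rcases liftFun_of_not (fun w hw hm => h ⟨w, hw, hm⟩) with ⟨z, hz, hzx, -, hv⟩ | ⟨-, h0⟩
    · obtain ⟨y, hyz, hy, hlt⟩ := exists_isLRMax_lt_of_not hz
      have := hx y.castSucc ((Fin.castSucc_lt_castSucc_iff.2 hyz).trans hzx)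
      rw [liftPerm_apply, liftPerm_apply, hv, liftFun_castSucc hy, Fin.succ_lt_succ_iff] at this
      exact lt_asymm this hlt
    · have hfirst : IsLRMax p ⟨0, hm⟩ := fun y hy => absurd hy (Nat.not_lt_zero _)
      have hx0 : x ≠ Fin.castSucc ⟨0, hm⟩ := fun h' => h ⟨_, h'.symm, hfirst⟩
      have hpos : Fin.castSucc ⟨0, hm⟩ < x := by
        rw [Fin.lt_def]
        exact Nat.pos_of_ne_zero fun h' => hx0 (Fin.ext h')
      have := hx _ hpos
      rw [liftPerm_apply p x, h0] at this
      exact absurd this (Fin.not_lt_zero _)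
  · rintro ⟨y, rfl, hy⟩
    exact hy.liftPerm

theorem liftPerm_injective {m : ℕ} : Function.Injective (liftPerm : Equiv.Perm (Fin m) → _) := by
  intro p p' h
  rcases Nat.eq_zero_or_pos m with rfl | hm
  · exact Subsingleton.elim _ _
  have hmax : ∀ y, IsLRMax p y ↔ IsLRMax p' y := by
    have key : ∀ p : Equiv.Perm (Fin m), ∀ y, IsLRMax (liftPerm p) y.castSucc ↔ IsLRMax p y := by
      intro p y
      rw [isLRMax_liftPerm_iff hm]
      exact ⟨fun ⟨z, hz, hm⟩ => Fin.castSucc_injective m hz ▸ hm, fun hy => ⟨y, rfl, hy⟩⟩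
    intro y
    rw [← key p, ← key p', h]
  have hfun : ∀ x, liftFun p x = liftFun p' x := fun x => congrArg (fun e => e x) h
  refine Equiv.ext fun z => ?_
  by_cases hz : IsLRMax p z
  · have := hfun z.castSucc
    rwa [liftFun_castSucc hz, liftFun_castSucc ((hmax z).1 hz), Fin.succ_inj] at this
  -- the value at `z` is found at the next position not carrying a left-to-right maximum
  · obtain ⟨x, ⟨hzx, hx⟩, hmin⟩ : ∃ x : Fin (m + 1), (z.castSucc < x ∧
        ∀ y : Fin m, y.castSucc = x → ¬ IsLRMax p y) ∧ ∀ w : Fin m, ¬ IsLRMax p w →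
        w.castSucc < x → w ≤ z := by
      classical
      obtain ⟨x, hx, hle⟩ := Finset.exists_min_image (Finset.univ.filter fun x : Fin (m + 1) =>
        z.castSucc < x ∧ ∀ y : Fin m, y.castSucc = x → ¬ IsLRMax p y) id
        ⟨Fin.last m, by
          rw [Finset.mem_filter]
          exact ⟨Finset.mem_univ _, Fin.castSucc_lt_last z,
            fun y hy => absurd hy (Fin.castSucc_lt_last y).ne⟩⟩
      rw [Finset.mem_filter] at hx
      refine ⟨x, hx.2, fun w hw hwx => ?_⟩
      by_contra! hlt
      refine absurd (hle w.castSucc (Finset.mem_filter.2 ⟨Finset.mem_univ _,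
        Fin.castSucc_lt_castSucc_iff.2 hlt, fun y hy => ?_⟩)) (not_le.2 hwx)
      rwa [Fin.castSucc_injective m hy]
    have key : ∀ p' : Equiv.Perm (Fin m), (∀ y, IsLRMax p y ↔ IsLRMax p' y) →
        liftFun p' x = (p' z).succ := by
      intro p' hmax
      rcases liftFun_of_not (p := p') (x := x) (fun y hy => by rw [← hmax]; exact hx y hy) with
        ⟨z', hz', hzx', hmin', h'⟩ | ⟨h', -⟩
      · rw [h', le_antisymm (hmin z' (by rwa [hmax]) hzx') (hmin' z (by rwa [← hmax]) hzx)]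
      · exact absurd ((hmax z).2 (h' z hzx)) hz
    have := hfun x
    rwa [key p fun _ => Iff.rfl, key p' hmax, Fin.succ_inj] at this

/-- `liftPerm p` is indecomposable: no proper nonempty initial segment of positions is mapped to an
initial segment of values. -/
theorem exists_le_liftPerm {m : ℕ} (p : Equiv.Perm (Fin m)) {t : ℕ} (ht : 0 < t) (htm : t ≤ m) :
    ∃ x : Fin (m + 1), x.val < t ∧ t ≤ (liftPerm p x).val := by
  obtain ⟨y, hy, hmax, hle⟩ := exists_isLRMax_le p ⟨t - 1, by omega⟩
  rw [Fin.le_def] at hy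
  refine ⟨y.castSucc, by simp at hy ⊢; omega, ?_⟩
  rw [liftPerm_apply, liftFun_castSucc hmax, Fin.val_succ]
  have hcard := Finset.card_le_card_of_injOn (s := Finset.Iic (⟨t - 1, by omega⟩ : Fin m))
    (t := Finset.Iic (p y)) p (fun z hz => by
      rw [Finset.coe_Iic, Set.mem_Iic] at *
      exact hle z hz) p.injective.injOn
  rw [Fin.card_Iic, Fin.card_Iic] at hcard
  simp only at hcard
  omega

section

variable {l : ℕ} {q : Equiv.Perm (Fin (l + 3))}

/-- If `q` is `1 ⊖ τ` with `τ` sum-indecomposable, then lifting preserves avoidance of `q`: a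
permutation avoids `q` if and only if its entries that are not left-to-right maxima avoid `τ`, and
lifting changes their pattern only by a new minimum in front. -/
theorem copies_liftPerm_eq_empty (hq : ∀ r s, r.val < 2 → r < s → q s < q r) {m : ℕ}
    {p : Equiv.Perm (Fin m)} (hp : copies q p = ∅) : copies q (liftPerm p) = ∅ := by
  rw [Set.eq_empty_iff_forall_notMem] at *
  intro e he
  have hbad : ∀ r, 0 < r → ∀ y : Fin m, y.castSucc = e r → ¬ IsLRMax p y := by
    intro r hr y hy hmax
    have h1 := hmax.liftPerm
    rw [hy] at h1
    exact lt_asymm (h1 (e 0) (e.strictMono hr)) ((he r 0).2 (hq 0 r (by simp) hr))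
  have h12 : (1 : Fin (l + 3)) < 2 := by
    rw [Fin.lt_def]
    change 1 % (l + 3) < 2 % (l + 3)
    rw [Nat.mod_eq_of_lt (by omega), Nat.mod_eq_of_lt (by omega)]
    norm_num
  have hpos1 : (liftPerm p (e 2)) < liftPerm p (e 1) := (he 2 1).2 (hq 1 2 (by simp) h12)
  have hone : ∀ r : Fin (l + 3), 0 < r → 1 ≤ r := by
    intro r hr
    rw [Fin.le_def]
    rw [Fin.lt_def] at hr
    simp at hr ⊢
    omega
  -- the second entry of the copy is not `0`, so a shifted entry of `p` stands there
  have hex : ∀ r, 0 < r → ∃ z : Fin m, ¬ IsLRMax p z ∧ z.castSucc < e r ∧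
      (∀ w : Fin m, ¬ IsLRMax p w → w.castSucc < e r → w ≤ z) ∧ liftPerm p (e r) = (p z).succ := by
    have h1 : ∃ z : Fin m, ¬ IsLRMax p z ∧ z.castSucc < e 1 := by
      rcases liftFun_of_not (hbad 1 (by simp)) with ⟨z, hz, hzx, -⟩ | ⟨-, h0⟩
      · exact ⟨z, hz, hzx⟩
      · rw [liftPerm_apply p (e 1), h0] at hpos1
        exact absurd hpos1 (Fin.not_lt_zero _)
    obtain ⟨z, hz, hz1⟩ := h1
    intro r hr
    rcases liftFun_of_not (hbad r hr) with h | ⟨h, -⟩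
    · exact h
    · exact absurd (h z (hz1.trans_le (e.monotone (hone r hr)))) hz
  have hne : Nonempty (Fin m) := ⟨(hex 1 (by simp)).choose⟩
  choose! f hf1 hf2 hf3 hf4 using hex
  obtain ⟨x, hx, -, hpx⟩ := exists_isLRMax_lt_of_not (hf1 1 (by simp))
  have hmono : ∀ r s, 0 < r → r < s → f r < f s := by
    intro r s hr hrs
    have hrl : e r ≠ Fin.last m :=
      ((e.strictMono hrs).trans_le (Fin.le_last _)).ne
    obtain ⟨w, hw⟩ := Fin.exists_castSucc_eq.2 hrl
    have h1 : w ≤ f s := hf3 s (hr.trans hrs) w (hbad r hr w hw) (hw ▸ e.strictMono hrs)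
    have h2 := hf2 r hr
    rw [← hw, Fin.castSucc_lt_castSucc_iff] at h2
    exact h2.trans_le h1
  have hord : ∀ r s, 0 < r → 0 < s → q r < q s → p (f r) < p (f s) := by
    intro r s hr hs h
    have := (he r s).2 h
    rwa [hf4 r hr, hf4 s hs, Fin.succ_lt_succ_iff] at this
  obtain ⟨e', he', -⟩ := exists_mem_copies_of_tail hq f hx hpx hmono hord
  exact hp e' he'

/-- Avoiders of length `n` whose first summand has length `i`. -/
def avoidersWithFirst (q : Equiv.Perm (Fin (l + 3))) (n i : ℕ) : Set (Equiv.Perm (Fin n)) :=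
  {p | (copies q p).ncard = 0 ∧ (∀ x : Fin n, x.val < i → (p x).val < i) ∧
    ∀ t, 0 < t → t < i → ∃ x : Fin n, x.val < t ∧ t ≤ (p x).val}

theorem mul_le_ncard_avoidersWithFirst (hq : ∀ r s, r.val < 2 → r < s → q s < q r)
    (i j : ℕ) :
    numPermsWithCopies q 0 i * numPermsWithCopies q 0 j
      ≤ (avoidersWithFirst q (i + 1 + j) (i + 1)).ncard := by
  rw [numPermsWithCopies, numPermsWithCopies, ← Set.ncard_prod]
  refine Set.ncard_le_ncard_of_injOn (fun x => directSum (liftPerm x.1) x.2) ?_ ?_ (Set.toFinite _)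
  · rintro ⟨σ, τ⟩ ⟨hσ, hτ⟩
    have hσ' : copies q σ = ∅ := (Set.ncard_eq_zero (Set.toFinite _)).1 hσ
    have hτ' : copies q τ = ∅ := (Set.ncard_eq_zero (Set.toFinite _)).1 hτ
    refine ⟨?_, fun x hx => ?_, fun t ht hti => ?_⟩
    · exact (Set.ncard_eq_zero (Set.toFinite _)).2
        (copies_directSum_eq_empty hq (copies_liftPerm_eq_empty hq hσ') hτ')
    · rw [show x = Fin.castAdd j ⟨x.val, hx⟩ from rfl, directSum_castAdd]
      exact (liftPerm σ ⟨x.val, hx⟩).isLt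
    · obtain ⟨x, hxt, hx⟩ := exists_le_liftPerm σ ht (Nat.lt_succ_iff.1 hti)
      refine ⟨Fin.castAdd j x, hxt, ?_⟩
      rw [directSum_castAdd]
      exact hx
  · rintro ⟨σ, τ⟩ - ⟨σ', τ'⟩ - h
    have h' := directSum_injective (a₁ := (liftPerm σ, τ)) (a₂ := (liftPerm σ', τ')) h
    rw [Prod.mk.injEq] at h'
    exact Prod.ext (liftPerm_injective h'.1) h'.2

theorem eq_of_mem_avoidersWithFirst {n i i' : ℕ} {p : Equiv.Perm (Fin n)} (hi : 0 < i)
    (hi' : 0 < i') (h : p ∈ avoidersWithFirst q n i) (h' : p ∈ avoidersWithFirst q n i') :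
    i = i' := by
  have key : ∀ i i', 0 < i → p ∈ avoidersWithFirst q n i → p ∈ avoidersWithFirst q n i' →
      ¬ i < i' := by
    rintro i i' hi ⟨-, h, -⟩ ⟨-, -, h'⟩ hlt
    obtain ⟨x, hx, hle⟩ := h' i hi hlt
    exact absurd (h x hx) (not_lt.2 hle)
  exact le_antisymm (not_lt.1 (key i' i hi' h' h)) (not_lt.1 (key i i' hi h h'))

theorem sum_antidiagonal_numPermsWithCopies_le (hq : ∀ r s, r.val < 2 → r < s → q s < q r)
    (n : ℕ) :
    ∑ ij ∈ Finset.HasAntidiagonal.antidiagonal n,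
        numPermsWithCopies q 0 ij.1 * numPermsWithCopies q 0 ij.2
      ≤ numPermsWithCopies q 0 (n + 1) := by
  classical
  calc ∑ ij ∈ Finset.HasAntidiagonal.antidiagonal n,
        numPermsWithCopies q 0 ij.1 * numPermsWithCopies q 0 ij.2
      ≤ ∑ ij ∈ Finset.HasAntidiagonal.antidiagonal n,
          (avoidersWithFirst q (n + 1) (ij.1 + 1)).toFinset.card := by
        refine Finset.sum_le_sum fun ij hij => ?_
        have hn : ij.1 + 1 + ij.2 = n + 1 := by
          rw [← Finset.HasAntidiagonal.mem_antidiagonal.1 hij]; omega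
        rw [← Set.ncard_eq_toFinset_card', ← hn]
        exact mul_le_ncard_avoidersWithFirst hq _ _
    _ = ((Finset.HasAntidiagonal.antidiagonal n).biUnion fun ij =>
          (avoidersWithFirst q (n + 1) (ij.1 + 1)).toFinset).card := by
        refine (Finset.card_biUnion fun ij hij ij' hij' hne => ?_).symm
        rw [Function.onFun, Finset.disjoint_left]
        intro p hp hp'
        rw [Set.mem_toFinset] at hp hp'
        have h1 := eq_of_mem_avoidersWithFirst (Nat.succ_pos _) (Nat.succ_pos _) hp hp'
        have h2 := Finset.HasAntidiagonal.mem_antidiagonal.1 hij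
        have h3 := Finset.HasAntidiagonal.mem_antidiagonal.1 hij'
        exact hne (Prod.ext (by omega) (by omega))
    _ ≤ numPermsWithCopies q 0 (n + 1) := by
        rw [numPermsWithCopies, Set.ncard_eq_toFinset_card']
        refine Finset.card_le_card fun p hp => ?_
        obtain ⟨ij, -, hp⟩ := Finset.mem_biUnion.1 hp
        rw [Set.mem_toFinset] at hp ⊢
        exact hp.1

theorem numPermsWithCopies_zero_zero : numPermsWithCopies q 0 0 = 1 := by
  have hall : ∀ p : Equiv.Perm (Fin 0), (copies q p).ncard = 0 := fun p => by
    rw [Set.ncard_eq_zero (Set.toFinite _), Set.eq_empty_iff_forall_notMem]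
    exact fun e => (e 0).elim0
  rw [numPermsWithCopies, show {p : Equiv.Perm (Fin 0) | (copies q p).ncard = 0} = {1} from
    Set.ext fun p => ⟨fun _ => Subsingleton.elim _ _, fun _ => hall p⟩, Set.ncard_singleton]

end

/-! ### The pattern `321 ⊖ ρ` -/

theorem skewSum_pattern321_lt {b : ℕ} (ρ : Equiv.Perm (Fin b)) (r s : Fin (3 + b))
    (hr : r.val < 2) (hrs : r < s) : skewSum pattern321 ρ s < skewSum pattern321 ρ r := by
  rw [Fin.lt_def] at hrs ⊢
  rw [show r = Fin.castAdd b ⟨r.val, by omega⟩ from rfl, skewSum_left]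
  rcases lt_or_ge s.val 3 with hs | hs
  · rw [show s = Fin.castAdd b ⟨s.val, hs⟩ from rfl, skewSum_left]
    simp only [pattern321, Fin.revPerm_apply, Fin.val_rev]
    omega
  · rw [show s = Fin.natAdd 3 ⟨s.val - 3, by omega⟩ from Fin.ext (by simp; omega), skewSum_right]
    have := (ρ ⟨s.val - 3, by omega⟩).isLt
    omega

theorem not_isRationalSeries_copiesGenFun {l : ℕ} {q : Equiv.Perm (Fin (l + 3))}
    (hq : ∀ r s, r.val < 2 → r < s → q s < q r) : ¬ IsRationalSeries (copiesGenFun q 1) :=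
  not_isRationalSeries_of_bounds (l + 3) numPermsWithCopies_zero_zero
    (numPermsWithCopies_one_le hq) (sum_antidiagonal_numPermsWithCopies_le hq)
    (numPermsWithCopies_zero_le hq)

theorem mainTheorem4 (k : ℕ) (hk : 3 ≤ k) (ρ : Equiv.Perm (Fin (k - 3))) :
    ¬ IsRationalSeries (copiesGenFun (skewSum pattern321 ρ) 1) := by
  have h : ∀ (m l : ℕ) (q : Equiv.Perm (Fin m)), m = l + 3 →
      (∀ r s, r.val < 2 → r < s → q s < q r) → ¬ IsRationalSeries (copiesGenFun q 1) := by
    rintro m l q rfl hq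
    exact not_isRationalSeries_copiesGenFun hq
  exact h _ (k - 3) _ (Nat.add_comm _ _) (skewSum_pattern321_lt ρ)
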